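/- Let $k\ge 1$ and, for $i=1,\dots,k$, let $p_i\in[0,1]$, $b_i>0$, and let $Z_i$ be a real random variable with distribution $$Z_i\sim(1-p_i)\,\delta_0+p_i\,\mathrm{Unif}[0,b_i].$$ Random variables $Z_1,\dots,Z_k$ with finite expectations are called jointly mixable if there is a coupling of them (a probability measure $\pi$ on $\mathbb{R}^k$ whose $i$-th marginal is the law of $Z_i$ for every $i$) under which $\sum_{i=1}^k z_i=\sum_{i=1}^k\mathbb{E}[Z_i]$ for $\pi$-almost every $z$. Consider the condition $$\max_{1\le i\le k} b_i\;\le\;\frac12\sum_{i=1}^k p_i b_i.\qquad(*)$$ If $(*)$ holds, then $Z_1,\dots,Z_k$ are jointly mixable. If $p_m>0$ for at least one index $m$ with $b_m=\max_i b_i$ (in particular, if all $p_i>0$), then the equivalence holds: $Z_1,\dots,Z_k$ are jointly mixable if and only if $(*)$ holds. -/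

import Mathlib

open MeasureTheory ProbabilityTheory

/-- The uniform distribution on the interval `[0, b]` (used for `b > 0`). -/
noncomputable def unifIcc (b : ℝ) : Measure ℝ :=
  ProbabilityTheory.cond volume (Set.Icc 0 b)

/-- The mixture `(1 - p) δ₀ + p Unif[0, b]` (used for `p ∈ [0, 1]` and `b > 0`). -/
noncomputable def zeroUnifMixture (p b : ℝ) : Measure ℝ :=
  ENNReal.ofReal (1 - p) • Measure.dirac 0 + ENNReal.ofReal p • unifIcc b

/-- `π` is a coupling of the real random variables `Z i` on `(Ω i, P i)`: a probability measure on
the product space whose `i`-th marginal is the law of `Z i`. The variables may live on different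
probability spaces. -/
structure IsCoupling {ι : Type*} {Ω : ι → Type*} [∀ i, MeasurableSpace (Ω i)]
    (P : ∀ i, Measure (Ω i)) (Z : ∀ i, Ω i → ℝ) (π : Measure (ι → ℝ)) : Prop where
  isProbabilityMeasure : IsProbabilityMeasure π
  map_eval : ∀ i, π.map (fun z => z i) = (P i).map (Z i)

/-- A joint mix of the `Z i`: a coupling under which the sum of the coordinates is almost surely
equal to the sum of the expectations. -/
structure IsJointMix {ι : Type*} [Fintype ι] {Ω : ι → Type*} [∀ i, MeasurableSpace (Ω i)]
    (P : ∀ i, Measure (Ω i)) (Z : ∀ i, Ω i → ℝ) (π : Measure (ι → ℝ)) : Prop where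
  isCoupling : IsCoupling P Z π
  sum_ae_eq : ∀ᵐ z ∂π, ∑ i, z i = ∑ i, ∫ ω, Z i ω ∂(P i)

/-- The random variables `Z i` have finite expectations and admit a joint mix. -/
def JointlyMixable {ι : Type*} [Fintype ι] {Ω : ι → Type*} [∀ i, MeasurableSpace (Ω i)]
    (P : ∀ i, Measure (Ω i)) (Z : ∀ i, Ω i → ℝ) : Prop :=
  (∀ i, Integrable (Z i) (P i)) ∧ ∃ π : Measure (ι → ℝ), IsJointMix P Z π

/-! Necessity: the coordinates are almost surely nonnegative, so `z m` is at most the constant sum,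
while its law charges every left neighbourhood of `b m`. Sufficiency is proved by duality. Write C
for the sum of the means. A Hahn–Banach argument and the Riesz–Markov–Kakutani theorem give the
coupling once ∑ E φ i (Z i) ≥ 0 whenever ∑ φ i (x i) ≥ 0 on the simplex x ≥ 0, ∑ x i = C. Let Φ i t
be the average of φ i over [0, t], so that E φ i (Z i) = (1 - p i) Φ i 0 + p i Φ i (b i). Take a
slope l and minimizers t i of Φ i x - l x on [0, C], with minimum g i. The expectation is then at
least g i + l p i b i, and the average of φ i over [s, t i] is at most g i + l (s + t i) for 0 ≤ s <
t i. If ∑ (s i + t i) = 2C = ∑ p i b i, the two bounds have equal sums, so it is enough that the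
uniform laws on [s i, t i] mix jointly. They do when no length exceeds half the total: a planar law
with every projection uniform on [-1, 1] (Archimedes) is projected along the sides of a closed
polygon with those side lengths. Choosing l so that C < ∑ t i ≤ 2C makes suitable s i available. -/

/-! ### A planar law with uniform projections -/

/-- The density of the orthogonal projection to the plane of the uniform law on the unit sphere. -/
noncomputable def discDensity (z : ℂ) : ENNReal :=
  ENNReal.ofReal ((2 * Real.pi)⁻¹ * (√(1 - ‖z‖ ^ 2))⁻¹)

lemma measurable_discDensity : Measurable discDensity := by
  unfold discDensity
  fun_prop

lemma lintegral_inv_sqrt_sub_sq {R : ℝ} (hR : 0 < R) :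
    ∫⁻ y, ENNReal.ofReal ((√(R ^ 2 - y ^ 2))⁻¹) = ENNReal.ofReal Real.pi := by
  have hout : ∀ y ∉ Set.Ioc (-R) R, ENNReal.ofReal ((√(R ^ 2 - y ^ 2))⁻¹) = 0 := by
    intro y hy
    have : R ^ 2 - y ^ 2 ≤ 0 := by
      by_contra! h
      have h2 : |y| < |R| := sq_lt_sq.mp (by linarith)
      rw [abs_of_pos hR, abs_lt] at h2
      exact hy ⟨h2.1, h2.2.le⟩
    rw [Real.sqrt_eq_zero_of_nonpos this]
    simp
  have hderiv : ∀ y ∈ Set.Ioo (-R) R,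
      HasDerivAt (fun y => Real.arcsin (y / R)) ((√(R ^ 2 - y ^ 2))⁻¹) y := by
    intro y hy
    have h1 : y / R ≠ -1 := by
      rw [ne_eq, div_eq_iff hR.ne']; linarith [hy.1]
    have h2 : y / R ≠ 1 := by
      rw [ne_eq, div_eq_iff hR.ne']; linarith [hy.2]
    have h := (Real.hasDerivAt_arcsin h1 h2).comp y ((hasDerivAt_id y).div_const R)
    refine h.congr_deriv ?_
    symm
    have : R ^ 2 - y ^ 2 = (1 - (y / R) ^ 2) * R ^ 2 := by field_simp
    rw [this, Real.sqrt_mul' _ (sq_nonneg R), Real.sqrt_sq hR.le, mul_inv]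
    simp
  have hcont : ContinuousOn (fun y => Real.arcsin (y / R)) (Set.Icc (-R) R) := by
    fun_prop
  have hle : -R ≤ R := by linarith
  have hint : IntegrableOn (fun y => (√(R ^ 2 - y ^ 2))⁻¹) (Set.Ioc (-R) R) :=
    intervalIntegral.integrableOn_deriv_of_nonneg hcont hderiv (fun y _ => by positivity)
  have hval : ∫ y in (-R)..R, (√(R ^ 2 - y ^ 2))⁻¹ = Real.pi := by
    rw [intervalIntegral.integral_eq_sub_of_hasDerivAt_of_le hle hcont hderiv
      ((intervalIntegrable_iff_integrableOn_Ioc_of_le hle).2 hint)]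
    simp [neg_div, div_self hR.ne']
  rw [← setLIntegral_eq_of_support_subset (s := Set.Ioc (-R) R)]
  · rw [← ofReal_integral_eq_lintegral_ofReal hint (ae_of_all _ fun y => by positivity),
      ← intervalIntegral.integral_of_le hle, hval]
  · intro y hy
    by_contra h
    exact hy (hout y h)

/-- Archimedes' hat-box theorem: the chord integral is π whatever the half-chord √(1 - x²). Off the
disc the density vanishes, since `√` of a negative number and `0⁻¹` are both 0. -/
lemma lintegral_discDensity_vertical (x : ℝ) :
    ∫⁻ y : ℝ, discDensity ⟨x, y⟩ = (Set.Ioo (-1 : ℝ) 1).indicator (fun _ => 2⁻¹) x := by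
  have hn : ∀ y : ℝ, discDensity ⟨x, y⟩
      = ENNReal.ofReal ((2 * Real.pi)⁻¹) * ENNReal.ofReal ((√((1 - x ^ 2) - y ^ 2))⁻¹) := by
    intro y
    rw [discDensity, ENNReal.ofReal_mul (by positivity), ← Complex.normSq_eq_norm_sq,
      Complex.normSq_mk]
    ring_nf
  simp_rw [hn]
  rw [lintegral_const_mul' _ _ ENNReal.ofReal_ne_top]
  by_cases hx : x ∈ Set.Ioo (-1 : ℝ) 1
  · have hpos : 0 < 1 - x ^ 2 := by nlinarith [hx.1, hx.2]
    have h := lintegral_inv_sqrt_sub_sq (Real.sqrt_pos.2 hpos)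
    rw [Real.sq_sqrt hpos.le] at h
    rw [h, ← ENNReal.ofReal_mul (by positivity), Set.indicator_of_mem hx]
    rw [show (2 * Real.pi)⁻¹ * Real.pi = (2 : ℝ)⁻¹ by field_simp,
      ENNReal.ofReal_inv_of_pos two_pos]
    simp
  · have hneg : ∀ y : ℝ, 1 - x ^ 2 - y ^ 2 ≤ 0 := by
      intro y
      by_contra! h
      have h2 : |x| < |1| := sq_lt_sq.mp (by nlinarith)
      rw [abs_one, abs_lt] at h2
      exact hx h2
    simp [Real.sqrt_eq_zero_of_nonpos (hneg _), Set.indicator_of_notMem hx]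

lemma lintegral_comp_re_mul_discDensity {g : ℝ → ENNReal} (hg : Measurable g) :
    ∫⁻ z : ℂ, g z.re * discDensity z = ∫⁻ x, g x ∂(cond volume (Set.Icc (-1 : ℝ) 1)) := by
  have hm : Measurable fun z : ℂ => g z.re * discDensity z :=
    (hg.comp Complex.measurable_re).mul measurable_discDensity
  rw [← (Complex.volume_preserving_equiv_real_prod.symm _).lintegral_comp_emb
    (MeasurableEquiv.measurableEmbedding _), Measure.volume_eq_prod, lintegral_prod]
  · simp only [Complex.measurableEquivRealProd_symm_apply]
    have : ∀ x : ℝ, ∫⁻ y : ℝ, g x * discDensity ⟨x, y⟩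
        = (Set.Ioo (-1 : ℝ) 1).indicator (fun x => 2⁻¹ * g x) x := by
      intro x
      rw [lintegral_const_mul _ (show Measurable fun y : ℝ => discDensity ⟨x, y⟩ from
        measurable_discDensity.comp
          (Complex.measurableEquivRealProd.symm.measurable.comp measurable_prodMk_left)),
        lintegral_discDensity_vertical]
      by_cases hx : x ∈ Set.Ioo (-1 : ℝ) 1 <;> simp [hx, mul_comm]
    simp_rw [this]
    rw [lintegral_indicator measurableSet_Ioo, lintegral_const_mul _ hg, ProbabilityTheory.cond,
      lintegral_smul_measure, Real.volume_Icc, setLIntegral_congr Ioo_ae_eq_Icc]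
    norm_num
  · exact (hm.comp Complex.measurableEquivRealProd.symm.measurable).aemeasurable

/-- A planar law all of whose one-dimensional projections are uniform on `[-1, 1]`. -/
lemma exists_measure_map_re_mul_eq_uniform :
    ∃ ρ : Measure ℂ, ∀ u : ℂ, ‖u‖ = 1 →
      ρ.map (fun z => (u * z).re) = cond volume (Set.Icc (-1 : ℝ) 1) := by
  refine ⟨volume.withDensity discDensity, fun u hu => ?_⟩
  have hmeas : Measurable fun z : ℂ => (u * z).re := by fun_prop
  ext A hA
  have hg : Measurable (A.indicator (1 : ℝ → ENNReal)) := measurable_one.indicator hA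
  -- The density is radial, so a rotation reduces every direction to the real axis.
  have hrot : MeasurePreserving (fun z : ℂ => u * z) := by
    have := (rotation ⟨u, by simpa [Submonoid.unitSphere] using hu⟩).measurePreserving
    exact this
  rw [Measure.map_apply hmeas hA, withDensity_apply _ (hmeas hA),
    ← lintegral_indicator (hmeas hA)]
  calc _ = ∫⁻ z : ℂ, A.indicator 1 (u * z).re * discDensity (u * z) := by
        refine lintegral_congr fun z => ?_
        have : discDensity (u * z) = discDensity z := by simp [discDensity, hu]
        rw [this]
        by_cases h : (u * z).re ∈ A
        · rw [Set.indicator_of_mem (show z ∈ (fun z : ℂ => (u * z).re) ⁻¹' A from h),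
            Set.indicator_of_mem h]
          simp
        · rw [Set.indicator_of_notMem (show z ∉ (fun z : ℂ => (u * z).re) ⁻¹' A from h),
            Set.indicator_of_notMem h]
          simp
    _ = ∫⁻ z : ℂ, A.indicator 1 z.re * discDensity z :=
        hrot.lintegral_comp (f := fun z : ℂ => A.indicator 1 z.re * discDensity z)
          ((hg.comp Complex.measurable_re).mul measurable_discDensity)
    _ = _ := by
        rw [lintegral_comp_re_mul_discDensity hg, lintegral_indicator_one hA]

/-! ### Closed polygons -/

/-- Three lengths satisfying the triangle inequalities are the side lengths of a triangle. -/
lemma exists_unit_smul_add_eq_zero {a b c : ℝ} (ha : 0 ≤ a) (hb : 0 ≤ b) (hc : 0 ≤ c)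
    (hab : c ≤ a + b) (hbc : a ≤ b + c) (hca : b ≤ c + a) :
    ∃ u v w : ℂ, ‖u‖ = 1 ∧ ‖v‖ = 1 ∧ ‖w‖ = 1 ∧ (a : ℂ) * u + b * v + c * w = 0 := by
  have hcont : Continuous fun θ : ℝ => ‖(a : ℂ) + b * Complex.exp (θ * Complex.I)‖ := by
    fun_prop
  have h0 : ‖(a : ℂ) + b * Complex.exp ((0 : ℝ) * Complex.I)‖ = a + b := by
    simp only [Complex.ofReal_zero, zero_mul, Complex.exp_zero, mul_one]
    rw [← Complex.ofReal_add, Complex.norm_real, Real.norm_of_nonneg (by positivity)]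
  have hpi : ‖(a : ℂ) + b * Complex.exp ((Real.pi : ℝ) * Complex.I)‖ = |a - b| := by
    rw [Complex.exp_pi_mul_I, mul_neg_one, ← sub_eq_add_neg, ← Complex.ofReal_sub,
      Complex.norm_real, Real.norm_eq_abs]
  -- The angle between the first two sides moves the length of their sum continuously from a + b to
  -- |a - b|.
  obtain ⟨θ, -, hθ⟩ : c ∈ (fun θ : ℝ => ‖(a : ℂ) + b * Complex.exp (θ * Complex.I)‖) ''
      Set.Icc 0 Real.pi := by
    refine intermediate_value_Icc' Real.pi_pos.le hcont.continuousOn ⟨?_, ?_⟩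
    · rw [hpi, abs_le]; constructor <;> linarith
    · rw [h0]; exact hab
  set v := Complex.exp (θ * Complex.I)
  have hv : ‖v‖ = 1 := Complex.norm_exp_ofReal_mul_I θ
  rcases hc.eq_or_lt with hc0 | hc0
  · refine ⟨1, v, 1, norm_one, hv, norm_one, ?_⟩
    rw [← hc0] at hθ ⊢
    simpa using hθ
  · have hcne : (c : ℂ) ≠ 0 := by exact_mod_cast hc0.ne'
    refine ⟨1, v, -((a : ℂ) + b * v) / c, norm_one, hv, ?_, ?_⟩
    · rw [norm_div, norm_neg, show ‖(a : ℂ) + b * v‖ = c from hθ, Complex.norm_real,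
        Real.norm_of_nonneg hc, div_self hc0.ne']
    · field_simp
      ring

/-- Lengths none of which exceeds half of their sum are the side lengths of a closed polygon. -/
lemma exists_unit_sum_mul_eq_zero {ι : Type*} [Fintype ι] [DecidableEq ι] {r : ι → ℝ} {L : ℝ}
    (h0 : ∀ i, 0 ≤ r i) (hL : ∀ i, r i ≤ L) (hsum : ∑ i, r i = 2 * L) :
    ∃ u : ι → ℂ, (∀ i, ‖u i‖ = 1) ∧ ∑ i, (r i : ℂ) * u i = 0 := by
  rcases le_or_gt L 0 with hL0 | hL0
  · have : ∀ i, r i = 0 := fun i => le_antisymm ((hL i).trans hL0) (h0 i)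
    exact ⟨fun _ => 1, by simp, by simp [this]⟩
  -- Add sides greedily until the total first exceeds L. The sides before, the crossing side j and
  -- the remaining sides then form three groups of length at most L, hence a triangle.
  have key : ∀ S : Finset ι, (∃ A : Finset ι, ∃ j ∉ A, ∑ i ∈ A, r i ≤ L ∧
      L < ∑ i ∈ A, r i + r j) ∨ ∑ i ∈ S, r i ≤ L := by
    intro S
    induction S using Finset.induction_on with
    | empty => right; simpa using hL0.le
    | insert j S hj ih =>
      rcases ih with ih | ih
      · exact Or.inl ih
      · rcases le_or_gt (∑ i ∈ S, r i + r j) L with h | h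
        · right; rw [Finset.sum_insert hj]; linarith
        · exact Or.inl ⟨S, j, hj, ih, h⟩
  rcases key Finset.univ with ⟨A, j, hj, hA, hAj⟩ | h
  · set B := (insert j A)ᶜ with hB
    have htot : ∑ i ∈ A, r i + r j + ∑ i ∈ B, r i = 2 * L := by
      rw [← hsum, ← Finset.sum_add_sum_compl (insert j A), Finset.sum_insert hj]; ring
    obtain ⟨u, v, w, hu, hv, hw, huvw⟩ := exists_unit_smul_add_eq_zero
      (Finset.sum_nonneg fun i _ => h0 i : 0 ≤ ∑ i ∈ A, r i) (h0 j)
      (Finset.sum_nonneg fun i _ => h0 i : 0 ≤ ∑ i ∈ B, r i)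
      (by linarith) (by linarith) (by linarith [hL j])
    refine ⟨fun i => if i ∈ A then u else if i = j then v else w, fun i => ?_, ?_⟩
    · dsimp only; split_ifs <;> assumption
    · rw [← Finset.sum_add_sum_compl (insert j A), Finset.sum_insert hj, ← hB, ← huvw]
      have h1 : ∑ i ∈ A, (r i : ℂ) * (if i ∈ A then u else if i = j then v else w)
          = ((∑ i ∈ A, r i : ℝ) : ℂ) * u := by
        rw [Complex.ofReal_sum, Finset.sum_mul]
        exact Finset.sum_congr rfl fun i hi => by rw [if_pos hi]
      have h2 : ∑ i ∈ B, (r i : ℂ) * (if i ∈ A then u else if i = j then v else w)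
          = ((∑ i ∈ B, r i : ℝ) : ℂ) * w := by
        rw [Complex.ofReal_sum, Finset.sum_mul]
        refine Finset.sum_congr rfl fun i hi => ?_
        simp only [hB, Finset.mem_compl, Finset.mem_insert, not_or] at hi
        rw [if_neg hi.2, if_neg hi.1]
      rw [h1, h2]
      simp only [if_neg hj, if_true]
      ring
  · linarith

/-! ### Choice of endpoints -/

/-- Lower endpoints for given upper endpoints `t i` of intervals whose centers sum to `C` and
whose half-lengths satisfy the polygon inequality. -/
lemma exists_lower_endpoints {ι : Type*} [Fintype ι] [DecidableEq ι] {t : ι → ℝ} {C : ℝ}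
    (h0 : ∀ i, 0 ≤ t i) (hC : ∀ i, t i ≤ C) (h1 : C < ∑ i, t i) (h2 : ∑ i, t i ≤ 2 * C) :
    ∃ s : ι → ℝ, (∀ i, 0 ≤ s i) ∧ (∀ i, 0 < t i → s i < t i) ∧ (∀ i, s i ≤ t i) ∧
      (∀ i, t i - s i ≤ ∑ j, t j - C) ∧ ∑ i, s i = 2 * C - ∑ i, t i := by
  set D := ∑ i, t i - C with hD
  have hDpos : 0 < D := by linarith
  -- This says that the least admissible lower endpoints, max (t i - D) 0, have sum at most the
  -- required C - D.
  have hmin : 2 * D ≤ ∑ i, min (t i) D := by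
    by_cases hall : ∀ i, t i ≤ D
    · rw [Finset.sum_congr rfl fun i _ => min_eq_left (hall i)]; linarith
    · push Not at hall
      obtain ⟨j, hj⟩ := hall
      have hrest : D ≤ ∑ i ∈ Finset.univ.erase j, min (t i) D := by
        by_cases hr : ∀ i ∈ Finset.univ.erase j, t i ≤ D
        · rw [Finset.sum_congr rfl fun i hi => min_eq_left (hr i hi)]
          have := Finset.add_sum_erase Finset.univ t (Finset.mem_univ j)
          linarith [hC j]
        · push Not at hr
          obtain ⟨i, hi, hiD⟩ := hr
          calc D = min (t i) D := (min_eq_right hiD.le).symm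
            _ ≤ _ := Finset.single_le_sum (f := fun i => min (t i) D)
              (fun i _ => le_min (h0 i) hDpos.le) hi
      have := Finset.add_sum_erase Finset.univ (fun i => min (t i) D) (Finset.mem_univ j)
      simp only [min_eq_right hj.le] at this
      linarith
  have hDC : D ≤ C := by linarith
  set l : ι → ℝ := fun i => t i - min (t i) D with hl
  have hlsum : ∑ i, l i = ∑ i, t i - ∑ i, min (t i) D := by simp [hl]
  -- Interpolate between l and t to reach the sum C - D; D > 0 gives θ < 1, hence nondegenerate
  -- intervals where t i > 0.
  set θ := (C - D - ∑ i, l i) / (∑ i, t i - ∑ i, l i) with hθ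
  have hden : 0 < ∑ i, t i - ∑ i, l i := by linarith
  have hθ0 : 0 ≤ θ := div_nonneg (by linarith) hden.le
  have hθ1 : θ < 1 := by rw [hθ, div_lt_one hden]; linarith
  have hm0 : ∀ i, 0 ≤ min (t i) D := fun i => le_min (h0 i) hDpos.le
  refine ⟨fun i => l i + θ * (t i - l i), fun i => ?_, fun i hi => ?_, fun i => ?_, fun i => ?_,
    ?_⟩
  · have := min_le_left (t i) D
    have : 0 ≤ l i := by simp only [hl]; linarith
    have := mul_nonneg hθ0 (hm0 i)
    simp only [hl] at *
    linarith
  · have := mul_pos (sub_pos.2 hθ1) (lt_min hi hDpos)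
    simp only [hl]
    linarith
  · have := mul_nonneg (sub_pos.2 hθ1).le (hm0 i)
    simp only [hl]
    linarith
  · have := mul_nonneg hθ0 (hm0 i)
    have := min_le_right (t i) D
    simp only [hl]
    linarith
  · rw [Finset.sum_add_distrib, ← Finset.mul_sum, Finset.sum_sub_distrib t l, hθ,
      div_mul_cancel₀ _ hden.ne']
    linarith

/-- Switching coordinates one at a time from `x` to `y`, the sum cannot jump over `(C, 2 * C]`. -/
lemma exists_selection_sum_mem_Ioc {ι : Type*} [Fintype ι] [DecidableEq ι] {x y : ι → ℝ} {C : ℝ}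
    (hx : ∀ i, 0 ≤ x i) (hy : ∀ i, y i ≤ C) (hxs : ∑ i, x i ≤ 2 * C) (hys : C < ∑ i, y i) :
    ∃ t : ι → ℝ, (∀ i, t i = x i ∨ t i = y i) ∧ C < ∑ i, t i ∧ ∑ i, t i ≤ 2 * C := by
  by_contra! hno
  have key : ∀ S : Finset ι, ∑ i, S.piecewise y x i ≤ C := by
    intro S
    have hor : ∀ S : Finset ι, ∀ i, S.piecewise y x i = x i ∨ S.piecewise y x i = y i := by
      intro S i
      by_cases hi : i ∈ S <;> simp [hi]
    induction S using Finset.induction_on with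
    | empty =>
      by_contra! h
      exact absurd (hno _ (hor _) h) (by simpa using hxs)
    | insert j S hj ih =>
      by_contra! h
      have h2 := hno _ (hor _) h
      have e1 := Finset.add_sum_erase Finset.univ ((insert j S).piecewise y x) (Finset.mem_univ j)
      have e2 := Finset.add_sum_erase Finset.univ (S.piecewise y x) (Finset.mem_univ j)
      have e3 : ∑ i ∈ Finset.univ.erase j, (insert j S).piecewise y x i
          = ∑ i ∈ Finset.univ.erase j, S.piecewise y x i := by
        refine Finset.sum_congr rfl fun i hi => ?_
        exact Finset.piecewise_insert_of_ne _ _ _ (Finset.ne_of_mem_erase hi)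
      simp only [Finset.piecewise_insert_self, Finset.piecewise_eq_of_notMem _ _ _ hj] at e1 e2
      -- One switch raises the sum by y j - x j ≤ C.
      linarith [hx j, hy j]
  have := key Finset.univ
  simp only [Finset.piecewise_univ] at this
  linarith

/-! ### Segment averages and mixing of uniform laws -/

/-- The average of `φ` over the interval with endpoints `s` and `t`. -/
noncomputable def segmentAverage (φ : ℝ → ℝ) (s t : ℝ) : ℝ :=
  2⁻¹ * ∫ x in (-1 : ℝ)..1, φ ((s + t) / 2 + (t - s) / 2 * x)

/-- Averaging over a fixed parameter interval gives degenerate segments the right value, so the atom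
at 0 is covered too. -/
lemma segmentAverage_self (φ : ℝ → ℝ) (t : ℝ) : segmentAverage φ t t = φ t := by
  simp only [segmentAverage, sub_self, zero_div, zero_mul, add_zero, intervalIntegral.integral_const,
    smul_eq_mul]
  ring_nf

lemma sub_mul_segmentAverage (φ : ℝ → ℝ) (s t : ℝ) :
    (t - s) * segmentAverage φ s t = ∫ x in s..t, φ x := by
  have h := intervalIntegral.mul_integral_comp_add_mul (a := -1) (b := 1) (f := φ)
    (c := (t - s) / 2) (d := (s + t) / 2)
  rw [show (s + t) / 2 + (t - s) / 2 * -1 = s by ring,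
    show (s + t) / 2 + (t - s) / 2 * 1 = t by ring] at h
  rw [← h, segmentAverage]
  ring

lemma continuous_segmentAverage {φ : ℝ → ℝ} (hφ : Continuous φ) (s : ℝ) :
    Continuous (segmentAverage φ s) := by
  unfold segmentAverage
  refine continuous_const.mul
    (intervalIntegral.continuous_parametric_intervalIntegral_of_continuous' ?_ _ _)
  simp only [Function.uncurry_def]
  fun_prop

lemma integral_cond_Icc {a b : ℝ} (hab : a < b) (φ : ℝ → ℝ) :
    ∫ x, φ x ∂(cond volume (Set.Icc a b)) = (b - a)⁻¹ * ∫ x in a..b, φ x := by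
  rw [ProbabilityTheory.cond, integral_smul_measure, Real.volume_Icc, ENNReal.toReal_inv,
    ENNReal.toReal_ofReal (by linarith), intervalIntegral.integral_of_le hab.le,
    integral_Icc_eq_integral_Ioc, smul_eq_mul]

lemma isProbabilityMeasure_cond_Icc {a b : ℝ} (hab : a < b) :
    IsProbabilityMeasure (cond (volume : Measure ℝ) (Set.Icc a b)) :=
  cond_isProbabilityMeasure_of_finite (by simp [hab]) (by simp)

/-- Uniform laws on intervals whose centers sum to `C` and whose half-lengths satisfy the polygon
inequality are jointly mixable (in dual form). -/
lemma sum_segmentAverage_nonneg {ι : Type*} [Fintype ι] [DecidableEq ι] {φ : ι → ℝ → ℝ}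
    (hφ : ∀ i, Continuous (φ i)) {s t : ι → ℝ} {C : ℝ} (hs : ∀ i, 0 ≤ s i)
    (hst : ∀ i, s i ≤ t i) (hD : ∀ i, t i - s i ≤ ∑ j, t j - C)
    (hsum : ∑ i, s i = 2 * C - ∑ i, t i)
    (hpos : ∀ x : ι → ℝ, (∀ i, 0 ≤ x i) → ∑ i, x i = C → 0 ≤ ∑ i, φ i (x i)) :
    0 ≤ ∑ i, segmentAverage (φ i) (s i) (t i) := by
  obtain ⟨ρ, hρ⟩ := exists_measure_map_re_mul_eq_uniform
  obtain ⟨u, hu, hu0⟩ := exists_unit_sum_mul_eq_zero (r := fun i => t i - s i)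
    (fun i => sub_nonneg.2 (hst i)) hD (by rw [Finset.sum_sub_distrib]; linarith)
  have hmeas : ∀ i, Measurable fun z : ℂ => (u i * z).re := fun i => by fun_prop
  set X : ι → ℂ → ℝ := fun i z => (s i + t i) / 2 + (t i - s i) / 2 * (u i * z).re with hX
  -- The fluctuations cancel pointwise because the polygon closes.
  have hXC : ∀ z, ∑ i, X i z = C := by
    intro z
    have h1 : ∑ i, (t i - s i) / 2 * (u i * z).re = 0 := by
      have h2 : ((∑ i, ((t i - s i : ℝ) : ℂ) * u i) * z).re = 0 := by
        rw [hu0, zero_mul, Complex.zero_re]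
      rw [Finset.sum_mul, Complex.re_sum] at h2
      simp only [mul_assoc, Complex.re_ofReal_mul] at h2
      simp only [div_mul_eq_mul_div, ← Finset.sum_div, h2, zero_div]
    simp only [hX, Finset.sum_add_distrib, h1, ← Finset.sum_div, hsum]
    ring
  have hbd : ∀ i, ∀ᵐ z ∂ρ, (u i * z).re ∈ Set.Icc (-1 : ℝ) 1 := by
    intro i
    have h : ∀ᵐ x ∂(cond (volume : Measure ℝ) (Set.Icc (-1 : ℝ) 1)), x ∈ Set.Icc (-1 : ℝ) 1 :=
      ae_cond_mem measurableSet_Icc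
    rw [← hρ (u i) (hu i)] at h
    exact ae_of_ae_map (hmeas i).aemeasurable h
  have hcont : ∀ i, Continuous fun x : ℝ => φ i ((s i + t i) / 2 + (t i - s i) / 2 * x) := by
    intro i
    have := hφ i
    fun_prop
  have hint : ∀ i, Integrable (fun z => φ i (X i z)) ρ := by
    intro i
    have h : Integrable (fun x : ℝ => φ i ((s i + t i) / 2 + (t i - s i) / 2 * x))
        (ρ.map fun z => (u i * z).re) := by
      rw [hρ _ (hu i), ProbabilityTheory.cond]
      refine Integrable.smul_measure ?_ (by simp)
      exact (hcont i).continuousOn.integrableOn_Icc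
    exact h.comp_measurable (hmeas i)
  have heq : ∀ i, segmentAverage (φ i) (s i) (t i) = ∫ z, φ i (X i z) ∂ρ := by
    intro i
    have h := integral_map (μ := ρ) (hmeas i).aemeasurable (hcont i).aestronglyMeasurable
    rw [← h, hρ _ (hu i), integral_cond_Icc (by norm_num), segmentAverage]
    norm_num
  simp_rw [heq]
  rw [← integral_finsetSum _ fun i _ => hint i]
  refine integral_nonneg_of_ae ?_
  filter_upwards [ae_all_iff.2 hbd] with z hz
  refine hpos (fun i => X i z) (fun i => ?_) (hXC z)
  have h1 := mul_nonneg (sub_nonneg.2 (hst i)) (by linarith [(hz i).1] : 0 ≤ 1 + (u i * z).re)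
  have := hs i
  simp only [hX]
  linarith

/-! ### The dual inequality -/

/-- For some slope `l`, minimizers `t i` of `Φ i x - l * x` over `[0, C]` have their sum in
`(C, 2 * C]`. -/
lemma exists_slope_minimizers {ι : Type*} [Fintype ι] [DecidableEq ι] {Φ : ι → ℝ → ℝ}
    (hΦ : ∀ i, Continuous (Φ i)) {C : ℝ} (hC : 0 < C) (hcard : 2 ≤ Fintype.card ι) :
    ∃ (l : ℝ) (t : ι → ℝ), (∀ i, t i ∈ Set.Icc 0 C) ∧
      (∀ i, ∀ x ∈ Set.Icc 0 C, Φ i (t i) - l * t i ≤ Φ i x - l * x) ∧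
      C < ∑ i, t i ∧ ∑ i, t i ≤ 2 * C := by
  obtain ⟨M, hM⟩ : ∃ M, ∀ i, ∀ x ∈ Set.Icc 0 C, |Φ i x| ≤ M := by
    have h : ∀ i, ∃ M, ∀ x ∈ Set.Icc 0 C, |Φ i x| ≤ M := fun i =>
      isCompact_Icc.exists_bound_of_continuousOn (hΦ i).continuousOn
    choose M hM using h
    refine ⟨∑ i, |M i|, fun i x hx => (hM i x hx).trans ((le_abs_self _).trans ?_)⟩
    exact Finset.single_le_sum (f := fun i => |M i|) (fun i _ => abs_nonneg _) (Finset.mem_univ i)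
  have h0mem : (0 : ℝ) ∈ Set.Icc 0 C := ⟨le_rfl, hC.le⟩
  have hCmem : C ∈ Set.Icc 0 C := ⟨hC.le, le_rfl⟩
  have hne : Nonempty ι := Fintype.card_pos_iff.1 (by omega)
  have hM0 : 0 ≤ M := (abs_nonneg _).trans (hM hne.some 0 h0mem)
  set n : ℝ := (Fintype.card ι : ℝ) with hn
  have hn2 : 2 ≤ n := by rw [hn]; exact_mod_cast hcard
  -- At slope ∓R every minimizer lies within C / (2n) of 0, respectively C, as Φ varies by at most
  -- 2M.
  set R := (2 * M + 1) * (2 * n) / C with hR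
  have hRC : R * C = (2 * M + 1) * (2 * n) := by rw [hR]; field_simp
  have hR0 : 0 < R := by positivity
  set G : Set (ℝ × (ι → ℝ)) := {q | q ∈ Set.Icc (-R) R ×ˢ (Set.univ.pi fun _ => Set.Icc 0 C) ∧
    ∀ i, ∀ x ∈ Set.Icc 0 C, Φ i (q.2 i) - q.1 * q.2 i ≤ Φ i x - q.1 * x} with hG
  have hGc : IsCompact G := by
    refine (isCompact_Icc.prod (isCompact_univ_pi fun _ => isCompact_Icc)).inter_right
      (t := {q | ∀ i, ∀ x ∈ Set.Icc 0 C, Φ i (q.2 i) - q.1 * q.2 i ≤ Φ i x - q.1 * x}) ?_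
    simp only [Set.ofPred_forall]
    refine isClosed_iInter fun i => isClosed_iInter fun x => isClosed_iInter fun _ => ?_
    have := hΦ i
    exact isClosed_le (by fun_prop) (by fun_prop)
  have hsc : Continuous fun q : ℝ × (ι → ℝ) => ∑ i, q.2 i := by fun_prop
  -- Two closed sets of slopes covering [-R, R] must meet. The bound 3/2 C keeps S₂ closed while
  -- forcing a sum above C.
  set S₁ := Prod.fst '' (G ∩ {q | ∑ i, q.2 i ≤ 2 * C})
  set S₂ := Prod.fst '' (G ∩ {q | 3 / 2 * C ≤ ∑ i, q.2 i})
  have hS₁ : IsClosed S₁ :=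
    ((hGc.inter_right (isClosed_le hsc continuous_const)).image continuous_fst).isClosed
  have hS₂ : IsClosed S₂ :=
    ((hGc.inter_right (isClosed_le continuous_const hsc)).image continuous_fst).isClosed
  have hex : ∀ l ∈ Set.Icc (-R) R, ∃ t, (l, t) ∈ G := by
    intro l hl
    have h : ∀ i, ∃ t ∈ Set.Icc 0 C, ∀ x ∈ Set.Icc 0 C, Φ i t - l * t ≤ Φ i x - l * x := by
      intro i
      have := hΦ i
      exact isCompact_Icc.exists_isMinOn ⟨0, h0mem⟩
        (f := fun x => Φ i x - l * x) (by fun_prop)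
    choose t ht ht' using h
    exact ⟨t, ⟨hl, fun i _ => ht i⟩, ht'⟩
  have hcover : Set.Icc (-R) R ⊆ S₁ ∪ S₂ := by
    intro l hl
    obtain ⟨t, ht⟩ := hex l hl
    rcases le_total (∑ i, t i) (2 * C) with h | h
    · exact Or.inl ⟨(l, t), ⟨ht, h⟩, rfl⟩
    · exact Or.inr ⟨(l, t), ⟨ht, show 3 / 2 * C ≤ ∑ i, t i by linarith⟩, rfl⟩
  have hlow : -R ∈ S₁ := by
    obtain ⟨t, ht⟩ := hex (-R) ⟨le_rfl, by linarith⟩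
    refine ⟨(-R, t), ⟨ht, ?_⟩, rfl⟩
    have hti : ∀ i, t i ≤ C / (2 * n) := by
      intro i
      have h1 := ht.2 i 0 h0mem
      have h2 := abs_le.1 (hM i (t i) (ht.1.2 i trivial))
      have h3 := abs_le.1 (hM i 0 h0mem)
      rw [le_div_iff₀ (by linarith)]
      simp only at h1
      have h4 : R * t i ≤ 2 * M + 1 := by linarith
      have h5 : R * (t i * (2 * n)) ≤ R * C := by
        rw [hRC]; nlinarith
      exact le_of_mul_le_mul_left h5 hR0
    calc ∑ i, t i ≤ ∑ _i : ι, C / (2 * n) := Finset.sum_le_sum fun i _ => hti i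
      _ = C / 2 := by
        rw [Finset.sum_const, Finset.card_univ, nsmul_eq_mul, ← hn]
        field_simp
      _ ≤ 2 * C := by linarith
  have hhigh : R ∈ S₂ := by
    obtain ⟨t, ht⟩ := hex R ⟨by linarith, le_rfl⟩
    refine ⟨(R, t), ⟨ht, ?_⟩, rfl⟩
    have hti : ∀ i, C - C / (2 * n) ≤ t i := by
      intro i
      have h1 := ht.2 i C hCmem
      have h2 := abs_le.1 (hM i (t i) (ht.1.2 i trivial))
      have h3 := abs_le.1 (hM i C hCmem)
      rw [sub_le_comm, le_div_iff₀ (by linarith)]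
      simp only at h1
      have h4 : R * (C - t i) ≤ 2 * M + 1 := by linarith
      have h5 : R * ((C - t i) * (2 * n)) ≤ R * C := by
        rw [hRC]; nlinarith
      exact le_of_mul_le_mul_left h5 hR0
    calc 3 / 2 * C ≤ n * (C - C / (2 * n)) := by
          have : n * (C - C / (2 * n)) = n * C - C / 2 := by field_simp
          nlinarith
      _ = ∑ _i : ι, (C - C / (2 * n)) := by
        rw [Finset.sum_const, Finset.card_univ, nsmul_eq_mul, ← hn]
      _ ≤ ∑ i, t i := Finset.sum_le_sum fun i _ => hti i
  obtain ⟨l, -, ⟨⟨l₁, x⟩, ⟨hx, hxs⟩, rfl⟩, ⟨⟨l₂, y⟩, ⟨hy, hys⟩, h12⟩⟩ :=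
    isPreconnected_closed_iff.1 isPreconnected_Icc S₁ S₂ hS₁ hS₂ hcover
      ⟨-R, ⟨le_rfl, by linarith⟩, hlow⟩ ⟨R, ⟨by linarith, le_rfl⟩, hhigh⟩
  simp only at h12
  subst h12
  simp only [Set.mem_ofPred_eq] at hxs hys
  obtain ⟨t, hor, ht1, ht2⟩ := exists_selection_sum_mem_Ioc (fun i => (hx.1.2 i trivial).1)
    (fun i => (hy.1.2 i trivial).2) hxs (by linarith)
  refine ⟨l₂, t, fun i => ?_, fun i => ?_, ht1, ht2⟩
  · rcases hor i with h | h <;> rw [h]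
    exacts [hx.1.2 i trivial, hy.1.2 i trivial]
  · rcases hor i with h | h <;> rw [h]
    exacts [hx.2 i, hy.2 i]

/-- The dual form of joint mixability of the mixtures `(1 - p i) δ₀ + p i Unif[0, b i]`. -/
lemma sum_mixture_segmentAverage_nonneg {ι : Type*} [Fintype ι] [DecidableEq ι]
    {φ : ι → ℝ → ℝ} (hφ : ∀ i, Continuous (φ i)) {p b : ι → ℝ} {C : ℝ}
    (hp : ∀ i, p i ∈ Set.Icc (0 : ℝ) 1) (hb : ∀ i, b i ∈ Set.Icc 0 C) (hC : 0 < C)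
    (hsum : ∑ i, p i * b i = 2 * C)
    (hpos : ∀ x : ι → ℝ, (∀ i, 0 ≤ x i) → ∑ i, x i = C → 0 ≤ ∑ i, φ i (x i)) :
    0 ≤ ∑ i, ((1 - p i) * φ i 0 + p i * segmentAverage (φ i) 0 (b i)) := by
  have hcard : 2 ≤ Fintype.card ι := by
    have h : ∑ i, p i * b i ≤ ∑ _i : ι, C := Finset.sum_le_sum fun i _ => by
      nlinarith [(hp i).1, (hp i).2, (hb i).1, (hb i).2]
    rw [hsum, Finset.sum_const, Finset.card_univ, nsmul_eq_mul] at h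
    exact_mod_cast le_of_mul_le_mul_right h hC
  obtain ⟨l, t, ht, hmin, ht1, ht2⟩ := exists_slope_minimizers
    (Φ := fun i => segmentAverage (φ i) 0) (fun i => continuous_segmentAverage (hφ i) 0) hC hcard
  obtain ⟨s, hs0, hslt, hst, hsD, hssum⟩ := exists_lower_endpoints (fun i => (ht i).1)
    (fun i => (ht i).2) ht1 ht2
  have hpiece := sum_segmentAverage_nonneg hφ hs0 hst hsD hssum hpos
  set Φ : ι → ℝ → ℝ := fun i => segmentAverage (φ i) 0 with hΦ
  set g : ι → ℝ := fun i => Φ i (t i) - l * t i with hg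
  -- For s < t the average is (t Φ t - s Φ s) / (t - s), with Φ t = g + l t and Φ s ≥ g + l s.
  have hupper : ∀ i, segmentAverage (φ i) (s i) (t i) ≤ g i + l * (s i + t i) := by
    intro i
    have hsmin := hmin i (s i) ⟨hs0 i, (hst i).trans (ht i).2⟩
    rcases (ht i).1.eq_or_lt with h0 | h0
    · have hs : s i = 0 := le_antisymm (h0 ▸ hst i) (hs0 i)
      rw [hs, hg]
      simp only [← h0, hΦ]
      simp
    · have hlt := hslt i h0
      refine le_of_mul_le_mul_left ?_ (sub_pos.2 hlt)
      rw [sub_mul_segmentAverage, ← intervalIntegral.integral_interval_sub_left (a := 0)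
        ((hφ i).intervalIntegrable _ _) ((hφ i).intervalIntegrable _ _)]
      have e1 := sub_mul_segmentAverage (φ i) 0 (t i)
      have e2 := sub_mul_segmentAverage (φ i) 0 (s i)
      rw [sub_zero] at e1 e2
      rw [← e1, ← e2]
      have h3 := mul_le_mul_of_nonneg_left hsmin (hs0 i)
      simp only [hg, hΦ] at *
      linarith
  have hlower : ∀ i, g i + l * (p i * b i) ≤
      (1 - p i) * φ i 0 + p i * segmentAverage (φ i) 0 (b i) := by
    intro i
    have h0 := mul_le_mul_of_nonneg_left (hmin i 0 ⟨le_rfl, hC.le⟩) (sub_nonneg.2 (hp i).2)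
    have h1 := mul_le_mul_of_nonneg_left (hmin i (b i) (hb i)) (hp i).1
    simp only [segmentAverage_self] at h0
    simp only [hg, hΦ]
    linarith
  calc 0 ≤ ∑ i, (g i + l * (s i + t i)) := hpiece.trans (Finset.sum_le_sum fun i _ => hupper i)
    _ = ∑ i, (g i + l * (p i * b i)) := by
      rw [Finset.sum_add_distrib, Finset.sum_add_distrib, ← Finset.mul_sum, ← Finset.mul_sum,
        Finset.sum_add_distrib, hssum, hsum]
      ring
    _ ≤ _ := Finset.sum_le_sum fun i _ => hlower i

/-! ### Duality -/

section

open scoped BoundedContinuousFunction CompactlySupported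

/-- If the integrals of separable functions `∑ i, φ i (x i)` that are nonnegative on the compact set
`K` are nonnegative, then the `μ i` have a coupling concentrated on `K`. -/
lemma exists_coupling_of_integral_nonneg {ι : Type*} [Fintype ι] [Nonempty ι] (μ : ι → Measure ℝ)
    [∀ i, IsProbabilityMeasure (μ i)] {K : Set (ι → ℝ)} (hK : IsCompact K)
    (hpos : ∀ φ : ι → ℝ →ᵇ ℝ, (∀ x ∈ K, 0 ≤ ∑ i, φ i (x i)) → 0 ≤ ∑ i, ∫ x, φ i x ∂(μ i)) :
    ∃ π : Measure (ι → ℝ), IsProbabilityMeasure π ∧ (∀ i, π.map (fun z => z i) = μ i) ∧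
      ∀ᵐ z ∂π, z ∈ K := by
  classical
  have : CompactSpace K := isCompact_iff_compactSpace.1 hK
  let T : (ι → ℝ →ᵇ ℝ) →ₗ[ℝ] C_c(K, ℝ) :=
    { toFun := fun φ =>
        { toFun := fun x => ∑ i, φ i (x.1 i)
          continuous_toFun := continuous_finsetSum _ fun i _ =>
            (φ i).continuous.comp ((continuous_apply i).comp continuous_subtype_val)
          hasCompactSupport' := HasCompactSupport.of_compactSpace _ }
      map_add' := fun φ ψ => by ext x; simp [Finset.sum_add_distrib]
      map_smul' := fun c φ => by ext x; simp [Finset.mul_sum] }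
  have hT : ∀ φ x, T φ x = ∑ i, φ i (x.1 i) := fun _ _ => rfl
  let I : (ι → ℝ →ᵇ ℝ) →ₗ[ℝ] ℝ :=
    { toFun := fun φ => ∑ i, ∫ x, φ i x ∂(μ i)
      map_add' := fun φ ψ => by
        simp only [← Finset.sum_add_distrib]
        exact Finset.sum_congr rfl fun i _ =>
          integral_add ((φ i).integrable _) ((ψ i).integrable _)
      map_smul' := fun c φ => by
        simp only [Finset.smul_sum, RingHom.id_apply]
        exact Finset.sum_congr rfl fun i _ => integral_smul c _ }
  have hI : ∀ φ, I φ = ∑ i, ∫ x, φ i x ∂(μ i) := fun _ => rfl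
  -- Working on pairs (φ, g) avoids checking that I factors through T: both (φ, -T φ) and (-φ, T φ)
  -- lie in the cone, so the extension satisfies Λ (0, T φ) = I φ.
  let cone : PointedCone ℝ ((ι → ℝ →ᵇ ℝ) × C_c(K, ℝ)) :=
    { carrier := {q | ∀ x, 0 ≤ T q.1 x + q.2 x}
      add_mem' := fun {q r} hq hr x => by
        have := add_nonneg (hq x) (hr x)
        simp only [Prod.fst_add, Prod.snd_add, map_add, CompactlySupportedContinuousMap.add_apply]
        linarith
      zero_mem' := fun x => by simp
      smul_mem' := fun c q hq x => by
        have := mul_nonneg c.2 (hq x)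
        have h : T ((c : ℝ) • q.1) x + ((c : ℝ) • q.2) x = c * (T q.1 x + q.2 x) := by
          rw [map_smul, CompactlySupportedContinuousMap.smul_apply,
            CompactlySupportedContinuousMap.smul_apply, smul_eq_mul, smul_eq_mul, mul_add]
        exact h ▸ this }
  let f : ((ι → ℝ →ᵇ ℝ) × C_c(K, ℝ)) →ₗ.[ℝ] ℝ :=
    { domain := Submodule.prod ⊤ ⊥
      toFun := (I.comp (LinearMap.fst ℝ _ _)).comp (Submodule.subtype _) }
  obtain ⟨Λ, hΛf, hΛ⟩ := riesz_extension cone f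
    (by
      rintro ⟨⟨φ, g⟩, hφ⟩ h
      obtain rfl : g = 0 := hφ.2
      refine hpos φ fun x hx => ?_
      simpa [hT] using h ⟨x, hx⟩)
    (by
      rintro ⟨φ, g⟩
      obtain ⟨M, hM⟩ := isCompact_univ.exists_bound_of_continuousOn
        (map_continuous (T φ + g)).continuousOn
      refine ⟨⟨(fun _ => BoundedContinuousFunction.const ℝ |M|, 0), trivial, rfl⟩, fun x => ?_⟩
      have h1 := (abs_le.1 ((hM x trivial).trans (le_abs_self M))).1
      have h2 : |M| ≤ ∑ _i : ι, |M| := by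
        rw [Finset.sum_const, Finset.card_univ, nsmul_eq_mul]
        have : (1 : ℝ) ≤ Fintype.card ι := by exact_mod_cast Fintype.card_pos
        nlinarith [abs_nonneg M]
      simp only [Prod.fst_add, Prod.snd_add, map_add, CompactlySupportedContinuousMap.add_apply,
        zero_add] at h1 ⊢
      rw [hT (fun _ => BoundedContinuousFunction.const ℝ |M|)]
      simp only [BoundedContinuousFunction.const_apply]
      linarith)
  have hΛT : ∀ φ, Λ (0, T φ) = I φ := by
    intro φ
    have h1 : Λ (φ, 0) = I φ := hΛf ⟨(φ, 0), trivial, rfl⟩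
    have h2 : 0 ≤ Λ (φ, -T φ) := hΛ _ fun x => by simp
    have h3 : 0 ≤ Λ (-φ, T φ) := hΛ _ fun x => by simp
    have e2 : Λ (φ, -T φ) = Λ (φ, 0) - Λ (0, T φ) := by rw [← map_sub]; simp
    have e3 : Λ (-φ, T φ) = Λ (0, T φ) - Λ (φ, 0) := by rw [← map_sub]; simp
    linarith
  let Λ' : C_c(K, ℝ) →ₚ[ℝ] ℝ := PositiveLinearMap.mk₀ (Λ.comp (LinearMap.inr ℝ _ _))
    fun g hg => hΛ _ fun x => by simpa using hg x
  have hΛ' : ∀ φ, ∫ x, T φ x ∂(RealRMK.rieszMeasure Λ') = I φ := fun φ => by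
    rw [RealRMK.integral_rieszMeasure]; exact hΛT φ
  set π₀ := RealRMK.rieszMeasure Λ'
  have : IsFiniteMeasure π₀ := inferInstance
  have hev : ∀ i, Measurable fun z : K => z.1 i := fun i =>
    (measurable_pi_apply i).comp measurable_subtype_coe
  have hmarg : ∀ i, π₀.map (fun z => z.1 i) = μ i := by
    intro i
    refine ext_of_forall_integral_eq_of_IsFiniteMeasure fun ψ => ?_
    rw [integral_map (hev i).aemeasurable ψ.continuous.aestronglyMeasurable]
    have h := hΛ' (Pi.single i ψ)
    have h1 : ∀ x : K, T (Pi.single i ψ) x = ψ (x.1 i) := by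
      intro x
      rw [hT, Finset.sum_eq_single i]
      · simp
      · intro j _ hj; simp [hj]
      · simp
    have h2 : I (Pi.single i ψ) = ∫ x, ψ x ∂(μ i) := by
      rw [hI, Finset.sum_eq_single i]
      · simp
      · intro j _ hj; simp [hj]
      · simp
    simpa only [h1, h2] using h
  have hmarg' : ∀ i, (π₀.map Subtype.val).map (fun z : ι → ℝ => z i) = μ i := by
    intro i
    rw [Measure.map_map (measurable_pi_apply i) measurable_subtype_coe]
    exact hmarg i
  refine ⟨π₀.map Subtype.val, ?_, hmarg', ?_⟩
  · have i : ι := Classical.arbitrary ι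
    have : IsProbabilityMeasure ((π₀.map Subtype.val).map fun z : ι → ℝ => z i) := by
      rw [hmarg' i]; infer_instance
    exact Measure.isProbabilityMeasure_of_map (fun z : ι → ℝ => z i)
  · rw [ae_map_iff (p := fun z => z ∈ K) measurable_subtype_coe.aemeasurable hK.measurableSet]
    exact ae_of_all _ fun x => x.2

end

/-! ### The mixtures and the theorem -/

lemma isProbabilityMeasure_zeroUnifMixture {p b : ℝ} (hp : p ∈ Set.Icc (0 : ℝ) 1) (hb : 0 < b) :
    IsProbabilityMeasure (zeroUnifMixture p b) := by
  have : IsProbabilityMeasure (unifIcc b) := isProbabilityMeasure_cond_Icc hb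
  constructor
  simp only [zeroUnifMixture, Measure.coe_add, Measure.coe_smul, Pi.add_apply, Pi.smul_apply,
    measure_univ, smul_eq_mul, mul_one]
  rw [← ENNReal.ofReal_add (sub_nonneg.2 hp.2) hp.1]
  simp

lemma ae_zeroUnifMixture_mem_Icc (p : ℝ) {b : ℝ} (hb : 0 < b) :
    ∀ᵐ x ∂(zeroUnifMixture p b), x ∈ Set.Icc 0 b := by
  rw [zeroUnifMixture, ae_add_measure_iff]
  refine ⟨Measure.ae_smul_measure ?_ _, Measure.ae_smul_measure ?_ _⟩
  · refine (ae_dirac_iff (p := fun x => x ∈ Set.Icc 0 b) measurableSet_Icc).2 ?_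
    exact ⟨le_rfl, hb.le⟩
  · exact ae_cond_mem measurableSet_Icc

lemma integral_zeroUnifMixture {p b : ℝ} (hp : p ∈ Set.Icc (0 : ℝ) 1) (hb : 0 < b) {φ : ℝ → ℝ}
    (hφ : Continuous φ) :
    ∫ x, φ x ∂(zeroUnifMixture p b) = (1 - p) * φ 0 + p * segmentAverage φ 0 b := by
  have hint : Integrable φ (unifIcc b) := by
    refine Integrable.smul_measure (hφ.continuousOn.integrableOn_Icc) ?_
    simp [hb]
  rw [zeroUnifMixture, integral_add_measure ((integrable_dirac (by simp)).smul_measure (by simp))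
    (hint.smul_measure (by simp)), integral_smul_measure, integral_smul_measure, integral_dirac,
    unifIcc, integral_cond_Icc hb, ENNReal.toReal_ofReal (sub_nonneg.2 hp.2),
    ENNReal.toReal_ofReal hp.1, ← sub_mul_segmentAverage, sub_zero, inv_mul_cancel_left₀ hb.ne']
  rfl

lemma integral_id_zeroUnifMixture {p b : ℝ} (hp : p ∈ Set.Icc (0 : ℝ) 1) (hb : 0 < b) :
    ∫ x, x ∂(zeroUnifMixture p b) = p * b / 2 := by
  rw [integral_zeroUnifMixture hp hb continuous_id']
  have h := sub_mul_segmentAverage (fun x => x) 0 b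
  rw [integral_id] at h
  have : segmentAverage (fun x => x) 0 b = b / 2 := by
    refine mul_left_cancel₀ hb.ne' ?_
    linarith
  rw [this]
  ring

lemma integrable_id_zeroUnifMixture {p b : ℝ} (hp : p ∈ Set.Icc (0 : ℝ) 1) (hb : 0 < b) :
    Integrable (fun x => x) (zeroUnifMixture p b) := by
  have := isProbabilityMeasure_zeroUnifMixture hp hb
  refine Integrable.of_bound (by fun_prop) b ?_
  filter_upwards [ae_zeroUnifMixture_mem_Icc p hb] with x hx
  rw [Real.norm_of_nonneg hx.1]
  exact hx.2

lemma le_of_ae_zeroUnifMixture_le {p b c : ℝ} (hp : 0 < p) (hb : 0 < b)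
    (h : ∀ᵐ x ∂(zeroUnifMixture p b), x ≤ c) : b ≤ c := by
  rw [zeroUnifMixture, ae_add_measure_iff] at h
  have h1 := (Measure.ae_ennreal_smul_measure_iff (by simpa using hp)).1 h.2
  by_contra! hc
  rw [unifIcc, ProbabilityTheory.cond,
    Measure.ae_ennreal_smul_measure_iff (by simp)] at h1
  -- The uniform part would give this nonempty interval mass zero.
  have h2 : volume (Set.Ioc (max 0 c) b) = 0 := by
    refine measure_mono_null ?_ ((ae_restrict_iff' measurableSet_Icc).1 h1)
    intro x hx hxc
    have := hxc ⟨(le_max_left _ _).trans hx.1.le, hx.2⟩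
    exact absurd (lt_of_le_of_lt (le_max_right 0 c) hx.1) (not_lt.2 this)
  rw [Real.volume_Ioc, ENNReal.ofReal_eq_zero] at h2
  have := max_lt hb hc
  linarith

theorem mainTheorem6 (k : ℕ) (hk : 1 ≤ k) (p b : Fin k → ℝ)
    (hp : ∀ i, p i ∈ Set.Icc (0 : ℝ) 1) (hb : ∀ i, 0 < b i)
    {Ω : Fin k → Type*} [∀ i, MeasurableSpace (Ω i)]
    (P : ∀ i, Measure (Ω i)) [∀ i, IsProbabilityMeasure (P i)]
    (Z : ∀ i, Ω i → ℝ) (hZ : ∀ i, HasLaw (Z i) (zeroUnifMixture (p i) (b i)) (P i)) :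
    ((⨆ i, b i) ≤ (1 / 2 : ℝ) * ∑ i, p i * b i → JointlyMixable P Z) ∧
    ((∃ m, b m = ⨆ i, b i ∧ 0 < p m) →
      (JointlyMixable P Z ↔ (⨆ i, b i) ≤ (1 / 2 : ℝ) * ∑ i, p i * b i)) := by
  have hne : Nonempty (Fin k) := ⟨⟨0, hk⟩⟩
  have hmean : ∑ i, ∫ ω, Z i ω ∂(P i) = (1 / 2 : ℝ) * ∑ i, p i * b i := by
    rw [Finset.mul_sum]
    refine Finset.sum_congr rfl fun i _ => ?_
    rw [(hZ i).integral_eq, integral_id_zeroUnifMixture (hp i) (hb i)]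
    ring
  have hsuff : (⨆ i, b i) ≤ (1 / 2 : ℝ) * ∑ i, p i * b i → JointlyMixable P Z := by
    intro h
    set C := (1 / 2 : ℝ) * ∑ i, p i * b i with hC
    have hbC : ∀ i, b i ≤ C := fun i => (le_ciSup (Set.finite_range b).bddAbove i).trans h
    have hC0 : 0 < C := (hb hne.some).trans_le (hbC _)
    have := fun i => isProbabilityMeasure_zeroUnifMixture (hp i) (hb i)
    -- On nonnegative points with sum C the upper bounds are automatic; the box only supplies
    -- compactness.
    set K : Set (Fin k → ℝ) := (Set.univ.pi fun _ => Set.Icc 0 C) ∩ {x | ∑ i, x i = C} with hKdef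
    have hK : IsCompact K := (isCompact_univ_pi fun _ => isCompact_Icc).inter_right
      (isClosed_eq (by fun_prop) continuous_const)
    obtain ⟨π, hπ, hmarg, hsupp⟩ := exists_coupling_of_integral_nonneg
      (fun i => zeroUnifMixture (p i) (b i)) hK (by
        intro φ hφ
        simp_rw [integral_zeroUnifMixture (hp _) (hb _) (φ _).continuous]
        refine sum_mixture_segmentAverage_nonneg (φ := fun i => φ i) (fun i => (φ i).continuous) hp
          (fun i => ⟨(hb i).le, hbC i⟩) hC0 (by rw [hC]; ring) fun x hx hxs => hφ x ⟨?_, hxs⟩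
        intro i _
        exact ⟨hx i, hxs ▸ Finset.single_le_sum (fun j _ => hx j) (Finset.mem_univ i)⟩)
    refine ⟨fun i => ?_, π, ⟨hπ, fun i => ?_⟩, ?_⟩
    · have h1 := integrable_id_zeroUnifMixture (hp i) (hb i)
      rw [← (hZ i).map_eq] at h1
      exact h1.comp_aemeasurable (hZ i).aemeasurable
    · rw [hmarg i, (hZ i).map_eq]
    · filter_upwards [hsupp] with z hz
      rw [hmean]
      exact hz.2
  refine ⟨hsuff, fun ⟨m, hm, hpm⟩ => ⟨?_, hsuff⟩⟩
  rintro ⟨-, π, ⟨⟨hπ, hmarg⟩, hsum⟩⟩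
  rw [← hm]
  have hmarg' : ∀ i, π.map (fun z => z i) = zeroUnifMixture (p i) (b i) := fun i => by
    rw [hmarg i, (hZ i).map_eq]
  have hnonneg : ∀ᵐ z ∂π, ∀ i, 0 ≤ z i := by
    refine ae_all_iff.2 fun i => ?_
    have h := ae_zeroUnifMixture_mem_Icc (p i) (hb i)
    rw [← hmarg' i] at h
    filter_upwards [ae_of_ae_map (measurable_pi_apply i).aemeasurable h] with z hz using hz.1
  refine le_of_ae_zeroUnifMixture_le hpm (hb m) ?_
  rw [← hmarg' m, ae_map_iff (f := fun z : Fin k → ℝ => z m) (measurable_pi_apply m).aemeasurable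
    measurableSet_Iic]
  filter_upwards [hnonneg, hsum] with z hz hzs
  rw [← hmean, ← hzs]
  exact Finset.single_le_sum (fun j _ => hz j) (Finset.mem_univ m)
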